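/- **Theorem (Safety of $1\Delta$-SMR).** Consider $n=2f+1$ replicas, at most $f$ of them Byzantine, in a reliable authenticated all-to-all network with unforgeable signatures, where every message sent by an honest replica is delivered within $\delta\le\Delta$ time ($\Delta>0$ known; there is no clock drift, and the replicas start at arbitrary times $\ge 0$). Blocks are $B_k=(b_k,h_{k-1})$ with a batch $b_k$ and the digest $h_{k-1}=H(B_{k-1})$ of the predecessor, where $H$ is collision-free; a first block $B_1$ carries a fixed value $h_0$ outside the range of $H$. A block *extends* its ancestors and itself; two blocks are *equivocating* if neither extends the other. A *certificate* $\mathcal C_v(B)$ consists of votes $\langle\mathrm{vote},B,v\rangle$ of $f+1$ distinct replicas; certified blocks are ranked by view, then by height. A *blame certificate* $\mathcal B_v$ consists of blames $\langle\mathrm{blame},v\rangle$ of $f+1$ distinct replicas. Each view $v$ has a leader known to all. An honest replica $i$ starts in the initial view and, in its current view $v$ with leader $L$, acts as follows. 1. *Propose.* If $i=L$, it broadcasts a signed proposal $\langle\mathrm{propose},B_k,\mathcal S,v\rangle_L$ every $\alpha>0$ time. In its first proposal in a view other than the initial one, $\mathcal S$ is a set of status messages of view $v-1$ from $f+1$ distinct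 replicas, and $B_k$ is a child of the highest certified block in $\mathcal S$; in the initial view the first proposal has $\mathcal S=\bot$ and a first block. Otherwise $\mathcal S=\bot$ and $B_k$ is a child of the last block proposed by $L$. 2. *Forward.* On receiving a valid proposal for $B_k$ signed by $L$ in view $v$, it forwards it to all. Once it knows the whole chain of $B_k$ and either $\mathcal S\ne\bot$ and $B_k$ extends the highest certified block in $\mathcal S$, or $\mathcal S=\bot$ and $B_k$ extends the highest certified block known to $i$, it broadcasts all blocks of that chain that it has not yet forwarded, and sets a vote-timer for $B_k$ to $\Delta$. 3. *Vote.* When the timer reaches $0$, if it has received neither equivocating blocks or proposals signed by $L$ in view $v$ nor $\mathcal B_v$ (messages arriving at that very moment included), it broadcasts $\langle\mathrm{vote},B_k,v\rangle_i$. (Two distinct proposals for the same view that both have $\mathcal S\neq\bot$ are equivocating; equivocating blocks count as received once both their chains are known.) 4. *Commit.* On receiving $f+1$ distinct votes for $B_k$ in view $v$, if it has received no such equivocation and no $\mathcal B_v$, it broadcasts $\mathcal C_v(B_k)$ and commits $B_k$ and all its ancestors. 5. *Blame.* If fewer than $p$ blocks are committed within $6\Delta+(p-1)\alpha$ time in view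 $v$ for some $p\ge1$, it broadcasts $\langle\mathrm{blame},v\rangle_i$; if it sees an equivocation by $L$, it broadcasts $\langle\mathrm{blame},v\rangle_i$ and the two equivocating proposals. 6. *New view.* On receiving $f+1$ distinct blames for view $v$, it broadcasts $\mathcal B_v$, stops voting in view $v$, waits $2\Delta$ and enters view $v+1$. It then sends the leader of view $v+1$ a signed status message of view $v$ with the highest certified block it knows and its certificate, and from then on ignores certificates of views $\le v$ that arrive later. The new leader waits another $2\Delta$ before proposing. Byzantine replicas behave arbitrarily, except that they cannot forge signatures of honest replicas. Then in every execution honest replicas commit the same block at each height: if honest replicas $r$ and $r'$ (possibly equal) commit blocks $B$ and $B'$, respectively, both of height $k$, then $B=B'$. -/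

import Mathlib

namespace OneDeltaSMR

/-! ### Blocks, signed messages and certificates -/

/-- A block `B_k = (b_k, h_{k-1})`: a batch of client requests and the digest of its predecessor. -/
structure Block (β 𝔻 : Type*) where
  batch : β
  prev : 𝔻

/-- A quorum certificate for `block` in `view`: the signed votes `⟨vote, block, view⟩_i` of the
replicas `i ∈ signers`. (It is valid when there are at least `f + 1` signers.) -/
structure Cert (n : ℕ) (β 𝔻 : Type*) where
  block : Block β 𝔻
  view : ℕ
  signers : Finset (Fin n)

/-- `⟨status, B, C(B), view⟩_sender`, where `C(B)` is the certificate `cert` and `B` its block;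
`none` reports that no block has been certified yet. -/
structure Status (n : ℕ) (β 𝔻 : Type*) where
  sender : Fin n
  cert : Option (Cert n β 𝔻)
  view : ℕ

/-- `⟨propose, block, status, view⟩_proposer`; `status = none` is the case `⊥`. -/
structure Proposal (n : ℕ) (β 𝔻 : Type*) where
  proposer : Fin n
  block : Block β 𝔻
  status : Option (Finset (Status n β 𝔻))
  view : ℕ

/-- Signed data. -/
inductive Signed (n : ℕ) (β 𝔻 : Type*) where
  | propose (P : Proposal n β 𝔻)
  | vote (i : Fin n) (B : Block β 𝔻) (v : ℕ)
  | blame (i : Fin n) (v : ℕ)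
  | status (s : Status n β 𝔻)

/-- Network messages: a single signed item, a bare block, a vote certificate, or a blame certificate
(the signed blames for view `v` of the replicas in `Q`). -/
inductive Msg (n : ℕ) (β 𝔻 : Type*) where
  | signed (x : Signed n β 𝔻)
  | block (B : Block β 𝔻)
  | cert (c : Cert n β 𝔻)
  | blameCert (v : ℕ) (Q : Finset (Fin n))

section Contents

variable {n : ℕ} {β 𝔻 : Type*}

/-- The replica whose signature an item carries. -/
def Signed.signer : Signed n β 𝔻 → Fin n
  | .propose P => P.proposer
  | .vote i _ _ => i
  | .blame i _ => i
  | .status s => s.sender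

/-- The signed votes that make up a certificate. -/
def Cert.votes (c : Cert n β 𝔻) : Set (Signed n β 𝔻) :=
  {x | ∃ i ∈ c.signers, x = .vote i c.block c.view}

/-- A status message carries its own signature and the votes in its certificate. -/
def Status.contents (s : Status n β 𝔻) : Set (Signed n β 𝔻) :=
  {x | x = .status s ∨ ∃ c, s.cert = some c ∧ x ∈ c.votes}

/-- A proposal carries its own signature and everything in its status messages. -/
def Proposal.contents (P : Proposal n β 𝔻) : Set (Signed n β 𝔻) :=
  {x | x = .propose P ∨ ∃ S, P.status = some S ∧ ∃ s ∈ S, x ∈ s.contents}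

/-- All signed items that a message carries, at any depth. -/
def Msg.contents : Msg n β 𝔻 → Set (Signed n β 𝔻)
  | .signed (.propose P) => P.contents
  | .signed (.vote i B v) => {.vote i B v}
  | .signed (.blame i v) => {.blame i v}
  | .signed (.status s) => s.contents
  | .block _ => ∅
  | .cert c => c.votes
  | .blameCert v Q => {x | ∃ i ∈ Q, x = .blame i v}

/-- The blocks that a message transports (votes and certificates only refer to blocks). -/
def Msg.blocks : Msg n β 𝔻 → Set (Block β 𝔻)
  | .signed (.propose P) => {P.block}
  | .block B => {B}
  | _ => ∅

end Contents

/-! ### Parameters, hash chaining and ranking -/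

/-- The parameters of the system: `2f + 1` replicas of which at most `f` will be Byzantine, the
known delay bound `Δ`, the actual delay bound `δ`, the proposal period `α`, the leader of each view
(for example `v mod n`), and an ideal (collision-free) hash function `H`; `h₀` is the fixed value
that the first block of a chain carries in place of the digest of a predecessor. -/
structure Setting (β 𝔻 : Type*) where
  f : ℕ
  Δ : ℝ
  δ : ℝ
  α : ℝ
  leader : ℕ → Fin (2 * f + 1)
  H : Block β 𝔻 → 𝔻
  h₀ : 𝔻
  Δ_pos : 0 < Δ
  δ_nonneg : 0 ≤ δ
  δ_le : δ ≤ Δ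
  α_pos : 0 < α
  H_injective : Function.Injective H
  H_ne : ∀ B, H B ≠ h₀

namespace Setting

variable {β 𝔻 : Type*} (S : Setting β 𝔻)

/-- The replicas. -/
abbrev Replica : Type := Fin (2 * S.f + 1)

/-- `S.Parent A B`: the block `A` is the predecessor of `B`. -/
def Parent (A B : Block β 𝔻) : Prop := B.prev = S.H A

/-- `S.Extends B A`: the block `A` equals `B` or is an ancestor of `B`. -/
def Extends (B A : Block β 𝔻) : Prop := Relation.ReflTransGen S.Parent A B

/-- `S.HasHeight B k`: the chain of `B` consists of `k` blocks. -/
inductive HasHeight : Block β 𝔻 → ℕ → Prop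
  | first {B : Block β 𝔻} : B.prev = S.h₀ → HasHeight B 1
  | succ {A B : Block β 𝔻} {k : ℕ} : S.Parent A B → HasHeight A k → HasHeight B (k + 1)

open Classical in
/-- The height of a block (`0` for a block whose chain does not lead back to a first block; such a
block never obtains a certificate). -/
noncomputable def height (B : Block β 𝔻) : ℕ :=
  if h : ∃ k, S.HasHeight B k then h.choose else 0

/-- Two blocks are equivocating if neither equals or extends the other. -/
def Equivocating (B B' : Block β 𝔻) : Prop := ¬ S.Extends B B' ∧ ¬ S.Extends B' B

/-- Certified blocks are ranked by view, then by height. -/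
noncomputable def rank (c : Cert (2 * S.f + 1) β 𝔻) : ℕ ×ₗ ℕ := toLex (c.view, S.height c.block)

/-- `B` extends the block certified by `o`; without a certificate there is nothing to extend. -/
def ExtendsCert (B : Block β 𝔻) (o : Option (Cert (2 * S.f + 1) β 𝔻)) : Prop :=
  ∀ c, o = some c → S.Extends B c.block

/-- The digest that a child of the block certified by `o` carries. -/
def digest (o : Option (Cert (2 * S.f + 1) β 𝔻)) : 𝔻 := o.elim S.h₀ fun c => S.H c.block

/-- A set of status messages of view `v` from at least `f + 1` distinct replicas, whose certificates
have at least `f + 1` votes each. -/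
def StatusQuorum (v : ℕ) (T : Finset (Status (2 * S.f + 1) β 𝔻)) : Prop :=
  S.f + 1 ≤ (T.image Status.sender).card ∧
    ∀ s ∈ T, s.view = v ∧ ∀ c, s.cert = some c → S.f + 1 ≤ c.signers.card

/-- `o` is a highest certificate among those in the status messages `T` (`none` if there is none). -/
def HighestIn (T : Finset (Status (2 * S.f + 1) β 𝔻)) (o : Option (Cert (2 * S.f + 1) β 𝔻)) : Prop :=
  (∃ s ∈ T, s.cert = o) ∧
    ∀ s ∈ T, ∀ c, s.cert = some c → ∃ c', o = some c' ∧ S.rank c ≤ S.rank c'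

/-- A valid proposal is signed by the leader of its view and contains either no status messages or
a quorum of status messages of the preceding view. -/
def ValidProposal (P : Proposal (2 * S.f + 1) β 𝔻) : Prop :=
  P.proposer = S.leader P.view ∧
    ∀ T, P.status = some T → ∃ v, v + 1 = P.view ∧ S.StatusQuorum v T

end Setting

/-! ### Traces -/

/-- A record of everything observable in a run: which replicas are honest, when each replica starts,
`sends p q m t` (`p` sends `m` to `q` at time `t`) and `receives q p m t` (`q` receives `m` from `p`
at time `t`). -/
structure Trace {β 𝔻 : Type*} (S : Setting β 𝔻) where
  honest : Finset S.Replica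
  start : S.Replica → ℝ
  sends : S.Replica → S.Replica → Msg (2 * S.f + 1) β 𝔻 → ℝ → Prop
  receives : S.Replica → S.Replica → Msg (2 * S.f + 1) β 𝔻 → ℝ → Prop

namespace Trace

variable {β 𝔻 : Type*} {S : Setting β 𝔻} (E : Trace S)

/-! #### What a replica knows at time `t` -/

/-- `r` has received the signed item `x`, possibly inside another message. -/
def Has (r : S.Replica) (x : Signed (2 * S.f + 1) β 𝔻) (t : ℝ) : Prop :=
  ∃ p m, ∃ s ≤ t, E.receives r p m s ∧ x ∈ m.contents

/-- `r` has received the block `B`. -/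
def HasBlock (r : S.Replica) (B : Block β 𝔻) (t : ℝ) : Prop :=
  ∃ p m, ∃ s ≤ t, E.receives r p m s ∧ B ∈ m.blocks

/-- `r` has received `B` and its complete chain of ancestors. -/
def KnowsChain (r : S.Replica) (B : Block β 𝔻) (t : ℝ) : Prop :=
  (∃ k, S.HasHeight B k) ∧ ∀ A, S.Extends B A → E.HasBlock r A t

/-- `r` has received the at least `f + 1` votes of the certificate `c`. -/
def KnowsCert (r : S.Replica) (c : Cert (2 * S.f + 1) β 𝔻) (t : ℝ) : Prop :=
  S.f + 1 ≤ c.signers.card ∧ ∀ x ∈ c.votes, E.Has r x t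

/-- `r` has received blames for view `v` from all members of `Q`, at least `f + 1` replicas. -/
def KnowsBlames (r : S.Replica) (v : ℕ) (Q : Finset S.Replica) (t : ℝ) : Prop :=
  S.f + 1 ≤ Q.card ∧ ∀ i ∈ Q, E.Has r (.blame i v) t

/-- `r` has received a blame certificate for view `v`, as a whole or in parts. -/
def HasBlameCert (r : S.Replica) (v : ℕ) (t : ℝ) : Prop := ∃ Q, E.KnowsBlames r v Q t

/-- `P` and `P'` are proposals for view `v` signed by its leader and received by `r`, which `r` can
tell to be equivocating: either it knows the chains of both blocks, and the blocks are equivocating,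
or the proposals are distinct and both contain status messages. -/
def EquivocatingPair (r : S.Replica) (v : ℕ) (P P' : Proposal (2 * S.f + 1) β 𝔻) (t : ℝ) : Prop :=
  (P.proposer = S.leader v ∧ P.view = v ∧ E.Has r (.propose P) t) ∧
  (P'.proposer = S.leader v ∧ P'.view = v ∧ E.Has r (.propose P') t) ∧
  ((E.KnowsChain r P.block t ∧ E.KnowsChain r P'.block t ∧ S.Equivocating P.block P'.block) ∨
    (P ≠ P' ∧ P.status ≠ none ∧ P'.status ≠ none))

/-- `r` has received equivocating blocks or proposals signed by the leader of view `v`. -/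
def SeesEquivocation (r : S.Replica) (v : ℕ) (t : ℝ) : Prop :=
  ∃ P P', E.EquivocatingPair r v P P' t

/-! #### Views -/

/-- `r` enters view `v` at time `t`: the initial view `0` when it starts, and view `v + 1` at `2Δ`
after the moment when it first was in view `v` and had a blame certificate for view `v`. -/
def Enters (r : S.Replica) : ℕ → ℝ → Prop
  | 0, t => t = E.start r
  | v + 1, t => IsLeast {s | (∃ s₀ ≤ s, Enters r v s₀) ∧ E.HasBlameCert r v s} (t - 2 * S.Δ)

/-- `r` stops working in view `v` at time `t`, having formed a blame certificate. -/
def Quits (r : S.Replica) (v : ℕ) (t : ℝ) : Prop :=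
  IsLeast {s | (∃ s₀ ≤ s, E.Enters r v s₀) ∧ E.HasBlameCert r v s} t

/-- The current view of `r` at time `t` is `v`. -/
def InView (r : S.Replica) (v : ℕ) (t : ℝ) : Prop :=
  (∃ s ≤ t, E.Enters r v s) ∧ ∀ s, E.Enters r (v + 1) s → t < s

/-- `r` knows `c` at time `t` and does not ignore it: on entering a view, a replica starts to ignore
the certificates of earlier views that it receives afterwards. -/
def ActiveCert (r : S.Replica) (c : Cert (2 * S.f + 1) β 𝔻) (t : ℝ) : Prop :=
  E.KnowsCert r c t ∧
    ∀ v, ∀ s ≤ t, E.Enters r (v + 1) s → c.view ≤ v → E.KnowsCert r c s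

/-- `o` certifies the highest certified block known to `r` (`none` if `r` knows no certificate). -/
def HighestCert (r : S.Replica) (o : Option (Cert (2 * S.f + 1) β 𝔻)) (t : ℝ) : Prop :=
  (∀ c, o = some c → E.ActiveCert r c t) ∧
    ∀ c, E.ActiveCert r c t → ∃ c', o = some c' ∧ S.rank c ≤ S.rank c'

/-! #### Vote timers and commits -/

/-- The condition for starting the vote timer of the proposal `P`. -/
def Ready (r : S.Replica) (P : Proposal (2 * S.f + 1) β 𝔻) (t : ℝ) : Prop :=
  E.InView r P.view t ∧ E.Has r (.propose P) t ∧ S.ValidProposal P ∧ E.KnowsChain r P.block t ∧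
    ((∃ T, P.status = some T ∧ ∃ o, S.HighestIn T o ∧ S.ExtendsCert P.block o) ∨
      (P.status = none ∧ ∃ o, E.HighestCert r o t ∧ S.ExtendsCert P.block o))

/-- `r` sets its vote timer for `P` to `Δ` at time `t`. -/
def SetsTimer (r : S.Replica) (P : Proposal (2 * S.f + 1) β 𝔻) (t : ℝ) : Prop :=
  IsLeast {s | E.Ready r P s} t

/-- At time `t` a vote timer of `r` for the block `B` in view `v` reaches `0`, and `r` has received
neither an equivocation nor a blame certificate (messages arriving at time `t` are included). -/
def VotesAt (r : S.Replica) (B : Block β 𝔻) (v : ℕ) (t : ℝ) : Prop :=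
  (∃ P, P.block = B ∧ P.view = v ∧ E.SetsTimer r P (t - S.Δ)) ∧
    E.InView r v t ∧ ¬ E.SeesEquivocation r v t ∧ ¬ E.HasBlameCert r v t

/-- At time `t`, replica `r` directly commits the block `B` in view `v`. -/
def DirectlyCommits (r : S.Replica) (B : Block β 𝔻) (v : ℕ) (t : ℝ) : Prop :=
  IsLeast {s | E.InView r v s ∧ ∃ c, c.block = B ∧ c.view = v ∧ E.KnowsCert r c s} t ∧
    ¬ E.SeesEquivocation r v t ∧ ¬ E.HasBlameCert r v t

/-- `r` commits `B`, directly or as an ancestor of a directly committed block. -/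
def Commits (r : S.Replica) (B : Block β 𝔻) : Prop :=
  ∃ B₀ v t, E.DirectlyCommits r B₀ v t ∧ S.Extends B₀ B

/-- The blocks that `r` newly commits in view `v`, up to time `t`. -/
def NewCommits (r : S.Replica) (v : ℕ) (t : ℝ) : Set (Block β 𝔻) :=
  {B | (∃ B₀, ∃ s ≤ t, E.DirectlyCommits r B₀ v s ∧ S.Extends B₀ B) ∧
    ∀ B₀, ∀ w < v, ∀ s, E.DirectlyCommits r B₀ w s → ¬ S.Extends B₀ B}

/-- Fewer than `p` blocks are committed in `6Δ + (p - 1)α` time in view `v`, for some `p ≥ 1`. -/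
def TimesOut (r : S.Replica) (v : ℕ) (t : ℝ) : Prop :=
  ∃ s, E.Enters r v s ∧ ∃ p : ℕ, 1 ≤ p ∧ t = s + 6 * S.Δ + ((p : ℝ) - 1) * S.α ∧
    (E.NewCommits r v t).encard < p

/-- `r` has a reason to blame the leader of its current view `v`. -/
def BlameTrigger (r : S.Replica) (v : ℕ) (t : ℝ) : Prop :=
  E.InView r v t ∧ (E.SeesEquivocation r v t ∨ E.TimesOut r v t)

/-! #### Proposing -/

/-- The time at which the leader `r` of view `v` makes its first proposal: at the start in the
initial view; otherwise `2Δ` after entering the view, as soon as a status quorum has arrived. -/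
def FirstProposalAt (r : S.Replica) : ℕ → ℝ → Prop
  | 0, t => E.Enters r 0 t
  | v + 1, t => ∃ s, E.Enters r (v + 1) s ∧
      IsLeast {u | s + 2 * S.Δ ≤ u ∧ ∃ T, S.StatusQuorum v T ∧ ∀ x ∈ T, E.Has r (.status x) u} t

/-- The content of the first proposal, made at time `t` in view `v`. -/
def FirstProposal (r : S.Replica) (P : Proposal (2 * S.f + 1) β 𝔻) : ℕ → ℝ → Prop
  | 0, _ => P.status = none ∧ P.block.prev = S.h₀
  | v + 1, t => ∃ T, P.status = some T ∧ S.StatusQuorum v T ∧ (∀ x ∈ T, E.Has r (.status x) t) ∧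
      ∃ o, S.HighestIn T o ∧ P.block.prev = S.digest o

/-- `r` sends `m` to all replicas at time `t`. (Its copy to itself arrives immediately.) -/
def Broadcasts (r : S.Replica) (m : Msg (2 * S.f + 1) β 𝔻) (t : ℝ) : Prop :=
  ∀ q, E.sends r q m t

/-- In view `v`, its leader `r` issues `Q 0, Q 1, …`, one every `α` time while it is in the view,
each block being the child of the one before, and it signs no other proposals. -/
structure Proposes (r : S.Replica) (v : ℕ) (Q : ℕ → Proposal (2 * S.f + 1) β 𝔻) : Prop where
  signed : ∀ j, (Q j).proposer = r ∧ (Q j).view = v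
  first : ∀ t, E.FirstProposalAt r v t → E.FirstProposal r (Q 0) v t
  next : ∀ j, (Q (j + 1)).status = none ∧ S.Parent (Q j).block (Q (j + 1)).block
  sent : ∀ t, E.FirstProposalAt r v t → ∀ j : ℕ, E.InView r v (t + j * S.α) →
    E.Broadcasts r (.signed (.propose (Q j))) (t + j * S.α)
  only : ∀ P q u, P.proposer = r → P.view = v → E.sends r q (.signed (.propose P)) u →
    ∃ t, E.FirstProposalAt r v t ∧
      ∃ j : ℕ, t + j * S.α ≤ u ∧ E.InView r v (t + j * S.α) ∧ P = Q j

/-! #### The protocol -/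

/-- The replica `r` runs the protocol. Fields ending in `_only` say what `r` does not do; the others
say what it does. -/
structure FollowsProtocol (r : S.Replica) : Prop where
  start_nonneg : 0 ≤ E.start r
  -- Propose
  propose : ∀ v, S.leader v = r → ∃ Q, E.Proposes r v Q
  propose_only : ∀ P q t, E.sends r q (.signed (.propose P)) t →
    (P.proposer = r ∧ S.leader P.view = r) ∨ E.Has r (.propose P) t
  -- Forward
  forward : ∀ P t, E.InView r P.view t → E.Has r (.propose P) t → S.ValidProposal P →
    ∃ s ≤ t, E.Broadcasts r (.signed (.propose P)) s
  forward_chain : ∀ P t, E.SetsTimer r P t → ∀ A, S.Extends P.block A →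
    ∃ m, A ∈ m.blocks ∧ ∃ s ≤ t, E.Broadcasts r m s
  block_only : ∀ A q t, E.sends r q (.block A) t →
    ∃ P, E.SetsTimer r P t ∧ S.Extends P.block A
  -- Vote
  vote : ∀ B v t, E.VotesAt r B v t → E.Broadcasts r (.signed (.vote r B v)) t
  vote_only : ∀ i B v q t, E.sends r q (.signed (.vote i B v)) t → i = r ∧ E.VotesAt r B v t
  -- Commit
  commit : ∀ B v t, E.DirectlyCommits r B v t →
    ∃ c, c.block = B ∧ c.view = v ∧ E.KnowsCert r c t ∧ E.Broadcasts r (.cert c) t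
  cert_only : ∀ c q t, E.sends r q (.cert c) t →
    E.DirectlyCommits r c.block c.view t ∧ E.KnowsCert r c t
  -- Blame
  blame : ∀ v t, E.BlameTrigger r v t → ∃ s ≤ t, E.Broadcasts r (.signed (.blame r v)) s
  blame_evidence : ∀ v t, E.InView r v t → E.SeesEquivocation r v t →
    ∃ P P', E.EquivocatingPair r v P P' t ∧
      (∃ s ≤ t, E.Broadcasts r (.signed (.propose P)) s) ∧
      (∃ s ≤ t, E.Broadcasts r (.signed (.propose P')) s)
  blame_only : ∀ i v q t, E.sends r q (.signed (.blame i v)) t → i = r ∧ E.BlameTrigger r v t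
  -- New-view
  newView : ∀ v t, E.Quits r v t → ∃ Q, E.KnowsBlames r v Q t ∧ E.Broadcasts r (.blameCert v Q) t
  blameCert_only : ∀ v Q q t, E.sends r q (.blameCert v Q) t →
    E.Quits r v t ∧ E.KnowsBlames r v Q t
  status : ∀ v t, E.Enters r (v + 1) t → ∃ o, E.HighestCert r o t ∧
    E.sends r (S.leader (v + 1)) (.signed (.status ⟨r, o, v⟩)) t
  status_only : ∀ s q t, E.sends r q (.signed (.status s)) t →
    s.sender = r ∧ q = S.leader (s.view + 1) ∧ E.Enters r (s.view + 1) t ∧ E.HighestCert r s.cert t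

/-- The trace is an execution of the protocol in a synchronous authenticated network with at most
`f` Byzantine replicas. Byzantine replicas may send anything to anyone at any time, except that they
cannot produce the signatures of honest replicas. -/
structure IsExecution : Prop where
  byzantine : E.honestᶜ.card ≤ S.f
  delivery : ∀ p ∈ E.honest, ∀ q m t, E.sends p q m t →
    ∃ s, t ≤ s ∧ s ≤ t + S.δ ∧ E.receives q p m s
  delivery_self : ∀ p ∈ E.honest, ∀ m t, E.sends p p m t → E.receives p p m t
  causality : ∀ q p m t, E.receives q p m t → ∃ s ≤ t, E.sends p q m s
  unforgeable : ∀ p q m t, E.sends p q m t → ∀ x ∈ m.contents, x.signer ∈ E.honest →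
    ∃ q', ∃ s ≤ t, E.sends x.signer q' (.signed x) s
  protocol : ∀ r ∈ E.honest, E.FollowsProtocol r

end Trace

end OneDeltaSMR

namespace OneDeltaSMR

/-! ### Message contents -/

section Contents

variable {n : ℕ} {β 𝔻 : Type*}

/-! Safety reduces to the claim that any two directly committed blocks are comparable under
`Extends`: all commits then lie on one chain, which has one block per height.

Same view: an honest voter relays the proposal and its chain at least `Δ` before voting, so the
later of two honest voters holds both chains and would have detected an equivocation
(`extends_or_extends_of_votesAt`). Every certificate contains an honest vote, so certified blocks of
one view are comparable.

Different views: the `2Δ` wait between a blame certificate and the next view gives `Δ` for the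
blames to reach a committer and `Δ` for its commit certificate to come back. Hence every honest
replica leaves the view knowing that certificate (`exists_cert_of_directlyCommits`). A later honest
vote extends a certificate ranked at least as high. By induction on time, every such certificate is
for an extension of the committed block (`extends_of_rank_le`, `extends_of_votesAt_of_lt`). -/

theorem Status.propose_notMem_contents (s : Status n β 𝔻) (P : Proposal n β 𝔻) :
    Signed.propose P ∉ s.contents := by
  rintro (h | ⟨c, -, i, -, h⟩) <;> cases h

/-- Proposals are never nested inside other signed data, so whoever holds one also holds the votes
justifying its status messages. -/
theorem Msg.contents_subset_of_propose_mem {m : Msg n β 𝔻} {P : Proposal n β 𝔻}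
    (h : Signed.propose P ∈ m.contents) : P.contents ⊆ m.contents := by
  match m, h with
  | .signed (.propose P'), h =>
    rcases h with h | ⟨T, -, s, -, h⟩
    · cases h
      exact subset_rfl
    · exact absurd h (s.propose_notMem_contents P)
  | .signed (.vote _ _ _), h => cases h
  | .signed (.blame _ _), h => cases h
  | .signed (.status s), h => exact absurd h (s.propose_notMem_contents P)
  | .block _, h => cases h
  | .cert _, ⟨_, _, h⟩ => cases h
  | .blameCert _ _, ⟨_, _, h⟩ => cases h

end Contents

/-! ### Chains and heights -/

namespace Setting

variable {β 𝔻 : Type*} {S : Setting β 𝔻}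

/-- `h₀` is not a digest, so a block with a parent is not a first block; injectivity of `H` makes
the parent unique. -/
theorem HasHeight.eq_succ_of_parent {A B : Block β 𝔻} {k : ℕ} (h : S.HasHeight B k)
    (hp : S.Parent A B) : ∃ j, k = j + 1 ∧ S.HasHeight A j := by
  cases h with
  | first h => exact absurd (hp.symm.trans h) (S.H_ne A)
  | @succ C _ j hC hk =>
    have : A = C := S.H_injective (hp.symm.trans hC)
    exact ⟨j, rfl, this ▸ hk⟩

theorem HasHeight.unique {B : Block β 𝔻} {k l : ℕ} (hk : S.HasHeight B k)
    (hl : S.HasHeight B l) : k = l := by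
  induction hk generalizing l with
  | first h =>
    cases hl with
    | first _ => rfl
    | succ hp _ => exact absurd (hp.symm.trans h) (S.H_ne _)
  | succ hp _ ih =>
    obtain ⟨j, rfl, hj⟩ := hl.eq_succ_of_parent hp
    rw [ih hj]

theorem HasHeight.height_eq {B : Block β 𝔻} {k : ℕ} (h : S.HasHeight B k) : S.height B = k := by
  have hex : ∃ k, S.HasHeight B k := ⟨k, h⟩
  rw [height, dif_pos hex]
  exact hex.choose_spec.unique h

theorem Extends.height_le {A B : Block β 𝔻} (h : S.Extends B A) {a b : ℕ}
    (ha : S.HasHeight A a) (hb : S.HasHeight B b) : a ≤ b ∧ (a = b → A = B) := by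
  induction h generalizing b with
  | refl => exact ⟨(ha.unique hb).le, fun _ => rfl⟩
  | tail _ hp ih =>
    obtain ⟨j, rfl, hj⟩ := hb.eq_succ_of_parent hp
    have := (ih hj).1
    exact ⟨by omega, fun h => by omega⟩

theorem Extends.trans {A B C : Block β 𝔻} (h : S.Extends C B) (h' : S.Extends B A) :
    S.Extends C A :=
  Relation.ReflTransGen.trans h' h

/-- The ancestors of a block form a chain. -/
theorem Extends.total {A B C : Block β 𝔻} (hA : S.Extends C A) (hB : S.Extends C B) :
    S.Extends A B ∨ S.Extends B A := by
  -- Walking backwards along a chain is deterministic because `H` is injective.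
  have hu : Relator.RightUnique (Function.swap S.Parent) := fun _ _ _ h h' =>
    S.H_injective (h.symm.trans h')
  have h := Relation.ReflTransGen.total_of_right_unique hu
    (Relation.reflTransGen_swap.2 hA) (Relation.reflTransGen_swap.2 hB)
  exact h.imp Relation.reflTransGen_swap.1 Relation.reflTransGen_swap.1

theorem Extends.eq_of_height {A B C : Block β 𝔻} {k : ℕ} (hA : S.Extends C A)
    (hB : S.Extends C B) (hkA : S.HasHeight A k) (hkB : S.HasHeight B k) : A = B :=
  (hA.total hB).elim (fun h => ((h.height_le hkB hkA).2 rfl).symm)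
    fun h => (h.height_le hkA hkB).2 rfl

end Setting

namespace Trace

variable {β 𝔻 : Type*} {S : Setting β 𝔻} {E : Trace S}

/-! ### Knowledge is monotone in time -/

theorem Has.mono {r : S.Replica} {x : Signed (2 * S.f + 1) β 𝔻} {s t : ℝ} (h : E.Has r x s)
    (hst : s ≤ t) : E.Has r x t := by
  obtain ⟨p, m, u, hu, hm⟩ := h
  exact ⟨p, m, u, hu.trans hst, hm⟩

theorem HasBlock.mono {r : S.Replica} {B : Block β 𝔻} {s t : ℝ} (h : E.HasBlock r B s)
    (hst : s ≤ t) : E.HasBlock r B t := by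
  obtain ⟨p, m, u, hu, hm⟩ := h
  exact ⟨p, m, u, hu.trans hst, hm⟩

theorem KnowsChain.mono {r : S.Replica} {B : Block β 𝔻} {s t : ℝ} (h : E.KnowsChain r B s)
    (hst : s ≤ t) : E.KnowsChain r B t :=
  ⟨h.1, fun A hA => (h.2 A hA).mono hst⟩

theorem KnowsCert.mono {r : S.Replica} {c : Cert (2 * S.f + 1) β 𝔻} {s t : ℝ}
    (h : E.KnowsCert r c s) (hst : s ≤ t) : E.KnowsCert r c t :=
  ⟨h.1, fun x hx => (h.2 x hx).mono hst⟩

/-- A proposal is only ever received together with everything it carries. -/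
theorem Has.of_mem_contents {r : S.Replica} {P : Proposal (2 * S.f + 1) β 𝔻}
    {x : Signed (2 * S.f + 1) β 𝔻} {t : ℝ} (h : E.Has r (.propose P) t) (hx : x ∈ P.contents) :
    E.Has r x t := by
  obtain ⟨p, m, s, hs, hm, hP⟩ := h
  exact ⟨p, m, s, hs, hm, Msg.contents_subset_of_propose_mem hP hx⟩

/-! ### Entering views -/

theorem Enters.quits {r : S.Replica} {v : ℕ} {t : ℝ} (h : E.Enters r (v + 1) t) :
    E.Quits r v (t - 2 * S.Δ) := by
  simpa only [Enters, Quits] using h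

theorem Enters.unique {r : S.Replica} {v : ℕ} {s t : ℝ} (hs : E.Enters r v s)
    (ht : E.Enters r v t) : s = t := by
  cases v with
  | zero =>
    simp only [Enters] at hs ht
    rw [hs, ht]
  | succ v => linarith [IsLeast.unique hs.quits ht.quits]

theorem Enters.exists_le {r : S.Replica} {v w : ℕ} {t : ℝ} (h : E.Enters r w t) (hvw : v ≤ w) :
    ∃ s ≤ t, E.Enters r v s := by
  induction w, hvw using Nat.le_induction generalizing t with
  | base => exact ⟨t, le_rfl, h⟩
  | succ w _ ih =>
    obtain ⟨s, hs, hsw⟩ := h.quits.1.1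
    obtain ⟨u, hu, huv⟩ := ih hsw
    exact ⟨u, by linarith [S.Δ_pos], huv⟩

/-- Entering a view beyond `c.view` requires having entered `c.view + 1` first, so a certificate
known by then is never among the ignored ones. -/
theorem KnowsCert.active_of_enters {r : S.Replica} {c : Cert (2 * S.f + 1) β 𝔻} {s t : ℝ}
    (h : E.KnowsCert r c s) (hs : E.Enters r (c.view + 1) s) (hst : s ≤ t) :
    E.ActiveCert r c t := by
  refine ⟨h.mono hst, fun v u _ hv hcv => ?_⟩
  obtain ⟨s', hs', he⟩ := hv.exists_le (Nat.succ_le_succ hcv)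
  exact h.mono (he.unique hs ▸ hs')

namespace IsExecution

/-! ### Communication -/

theorem exists_receives (hE : E.IsExecution) {p : S.Replica} (hp : p ∈ E.honest)
    {m : Msg (2 * S.f + 1) β 𝔻} {t u : ℝ} (h : E.Broadcasts p m t) (htu : t + S.Δ ≤ u)
    (q : S.Replica) : ∃ s ≤ u, E.receives q p m s := by
  obtain ⟨s, -, hs, hr⟩ := hE.delivery p hp q m t (h q)
  exact ⟨s, by linarith [S.δ_le], hr⟩

/-- Even if a Byzantine replica relayed the item, unforgeability traces it to an earlier
transmission by its signer. -/
theorem exists_sends_of_has (hE : E.IsExecution) {r : S.Replica}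
    {x : Signed (2 * S.f + 1) β 𝔻} {t : ℝ} (h : E.Has r x t) (hx : x.signer ∈ E.honest) :
    ∃ q, ∃ s ≤ t, E.sends x.signer q (.signed x) s := by
  obtain ⟨p, m, u, hu, hm, hxm⟩ := h
  obtain ⟨s, hs, hsend⟩ := hE.causality r p m u hm
  obtain ⟨q, s', hs', h'⟩ := hE.unforgeable p r m s hsend x hxm hx
  exact ⟨q, s', by linarith, h'⟩

theorem exists_honest_mem (hE : E.IsExecution) {Q : Finset S.Replica} (hQ : S.f + 1 ≤ Q.card) :
    ∃ i ∈ Q, i ∈ E.honest := by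
  by_contra! h
  have := Finset.card_le_card (fun i hi => Finset.mem_compl.2 (h i hi) : Q ⊆ E.honestᶜ)
  have := hE.byzantine
  omega

theorem votesAt_of_has (hE : E.IsExecution) {r i : S.Replica} {B : Block β 𝔻} {v : ℕ} {t : ℝ}
    (h : E.Has r (.vote i B v) t) (hi : i ∈ E.honest) : ∃ s ≤ t, E.VotesAt i B v s := by
  obtain ⟨q, s, hs, hsend⟩ := hE.exists_sends_of_has h hi
  exact ⟨s, hs, ((hE.protocol i hi).vote_only _ _ _ _ _ hsend).2⟩

/-- Every certificate whose votes were received contains an earlier honest vote. -/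
theorem exists_honest_vote (hE : E.IsExecution) {r : S.Replica} {c : Cert (2 * S.f + 1) β 𝔻}
    {t : ℝ} (h : E.KnowsCert r c t) :
    ∃ i ∈ E.honest, ∃ s ≤ t, E.VotesAt i c.block c.view s := by
  obtain ⟨i, hi, hh⟩ := hE.exists_honest_mem h.1
  exact ⟨i, hh, hE.votesAt_of_has (h.2 _ ⟨i, hi, rfl⟩) hh⟩

/-! ### Votes within one view -/

theorem _root_.OneDeltaSMR.Trace.VotesAt.exists_hasHeight {i : S.Replica} {B : Block β 𝔻}
    {v : ℕ} {t : ℝ} (h : E.VotesAt i B v t) : ∃ k, S.HasHeight B k := by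
  obtain ⟨⟨P, rfl, -, hP⟩, -⟩ := h
  exact hP.1.2.2.2.1.1

/-- By the time an honest replica votes, everyone has received the proposal and its chain. -/
theorem known_of_votesAt (hE : E.IsExecution) {i : S.Replica} (hi : i ∈ E.honest)
    {B : Block β 𝔻} {v : ℕ} {t : ℝ} (h : E.VotesAt i B v t) (q : S.Replica) :
    ∃ P : Proposal (2 * S.f + 1) β 𝔻, P.block = B ∧ P.proposer = S.leader v ∧ P.view = v ∧
      E.Has q (.propose P) t ∧ E.KnowsChain q P.block t := by
  obtain ⟨⟨P, rfl, rfl, hP⟩, -⟩ := h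
  obtain ⟨hview, hhas, hvalid, hchain, -⟩ := hP.1
  refine ⟨P, rfl, hvalid.1, rfl, ?_, hchain.1, fun A hA => ?_⟩
  -- The timer started at `t - Δ`, and forwarding happened no later, so delivery is complete by `t`.
  · obtain ⟨s, hs, hb⟩ := (hE.protocol i hi).forward P _ hview hhas hvalid
    obtain ⟨u, hu, hr⟩ := hE.exists_receives hi hb (u := t) (by linarith) q
    exact ⟨i, _, u, hu, hr, Or.inl rfl⟩
  · obtain ⟨m, hm, s, hs, hb⟩ := (hE.protocol i hi).forward_chain P _ hP A hA
    obtain ⟨u, hu, hr⟩ := hE.exists_receives hi hb (u := t) (by linarith) q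
    exact ⟨i, m, u, hu, hr, hm⟩

/-- The later voter `j` is the one that detects the conflict. Simultaneous votes are covered because
the check at time `t` includes messages arriving at `t`. -/
theorem not_equivocating_of_votesAt_le (hE : E.IsExecution) {i j : S.Replica}
    (hi : i ∈ E.honest) (hj : j ∈ E.honest) {B C : Block β 𝔻} {v : ℕ} {s t : ℝ}
    (hB : E.VotesAt i B v s) (hC : E.VotesAt j C v t) (hst : s ≤ t) :
    ¬ S.Equivocating B C := by
  intro heq
  obtain ⟨P, rfl, hP, hPv, hPh, hPk⟩ := hE.known_of_votesAt hi hB j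
  obtain ⟨P', rfl, hP', hPv', hPh', hPk'⟩ := hE.known_of_votesAt hj hC j
  exact hC.2.2.1 ⟨P, P', ⟨hP, hPv, hPh.mono hst⟩, ⟨hP', hPv', hPh'⟩,
    Or.inl ⟨hPk.mono hst, hPk', heq⟩⟩

/-- Honest replicas never vote for equivocating blocks in the same view. -/
theorem extends_or_extends_of_votesAt (hE : E.IsExecution) {i j : S.Replica}
    (hi : i ∈ E.honest) (hj : j ∈ E.honest) {B C : Block β 𝔻} {v : ℕ} {s t : ℝ}
    (hB : E.VotesAt i B v s) (hC : E.VotesAt j C v t) : S.Extends B C ∨ S.Extends C B := by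
  by_contra! h
  rcases le_total s t with hst | hts
  · exact hE.not_equivocating_of_votesAt_le hi hj hB hC hst h
  · exact hE.not_equivocating_of_votesAt_le hj hi hC hB hts h.symm

/-! ### Votes in later views -/

/-- A certificate that leads to a direct commit is known to every honest replica when it leaves
the view. -/
theorem exists_cert_of_directlyCommits (hE : E.IsExecution) {r : S.Replica}
    (hr : r ∈ E.honest) {B : Block β 𝔻} {v : ℕ} {t : ℝ} (h : E.DirectlyCommits r B v t) :
    ∃ c : Cert (2 * S.f + 1) β 𝔻, c.block = B ∧ c.view = v ∧ E.KnowsCert r c t ∧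
      ∀ q ∈ E.honest, ∀ w > v, ∀ s u, E.Enters q w s → s ≤ u → E.ActiveCert q c u := by
  obtain ⟨c, hcB, hcv, hck, hcb⟩ := (hE.protocol r hr).commit B v t h
  refine ⟨c, hcB, hcv, hck, fun q hq w hw s u hs hsu => ?_⟩
  obtain ⟨e, hes, he⟩ := hs.exists_le (Nat.succ_le_of_lt hw)
  -- The blame certificate that `q` broadcasts at `e - 2Δ` reaches `r` by `e - Δ`; from then on `r`
  -- could not commit in view `v`.
  have hlt : t < e - S.Δ := by
    by_contra! hle
    obtain ⟨Q, hQ, hQb⟩ := (hE.protocol q hq).newView v _ he.quits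
    obtain ⟨a, ha, hra⟩ := hE.exists_receives hq hQb (u := t) (by linarith) r
    exact h.2.2 ⟨Q, hQ.1, fun i hi => ⟨q, _, a, ha, hra, i, hi, rfl⟩⟩
  obtain ⟨a, ha, hqa⟩ := hE.exists_receives hr hcb (u := e) (by linarith) q
  have hk : E.KnowsCert q c e := ⟨hck.1, fun x hx => ⟨r, _, a, ha, hqa, hx⟩⟩
  subst hcv
  exact hk.active_of_enters he (hes.trans hsu)

/-- A vote for a block that extends a certificate ranked at least as high as a committed one is a
vote for an extension of the committed block, if this holds for all earlier votes. -/
theorem extends_of_rank_le (hE : E.IsExecution) {r q : S.Replica}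
    {c d : Cert (2 * S.f + 1) β 𝔻} {t u : ℝ} (hc : E.KnowsCert r c t) (hd : E.KnowsCert q d u)
    (hcd : S.rank c ≤ S.rank d)
    (ih : ∀ j ∈ E.honest, ∀ C, ∀ w > c.view, ∀ s ≤ u, E.VotesAt j C w s →
      S.Extends C c.block) : S.Extends d.block c.block := by
  obtain ⟨i, hi, s, -, hiv⟩ := hE.exists_honest_vote hc
  obtain ⟨j, hj, s', hs', hjv⟩ := hE.exists_honest_vote hd
  -- A later view is handled by `ih` applied to an honest vote in `d`. In the same view the blocks
  -- are comparable, and the height order fixes the direction.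
  rcases Prod.Lex.toLex_le_toLex.1 hcd with hlt | ⟨heq, hle⟩
  · exact ih j hj _ _ hlt s' hs' hjv
  · simp only at heq hle
    rw [← heq] at hjv
    obtain ⟨a, ha⟩ := hiv.exists_hasHeight
    obtain ⟨b, hb⟩ := hjv.exists_hasHeight
    rw [ha.height_eq, hb.height_eq] at hle
    rcases hE.extends_or_extends_of_votesAt hi hj hiv hjv with h | h
    · have h' := h.height_le hb ha
      rw [h'.2 (le_antisymm h'.1 hle)]
      exact Relation.ReflTransGen.refl
    · exact h

/-- Induction on time in units of `Δ`: a vote at `u` relies only on certificates known at `u - Δ`,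
when its timer was set, hence on honest votes cast by then. -/
theorem extends_of_votesAt_of_lt (hE : E.IsExecution) {r : S.Replica} (hr : r ∈ E.honest)
    {B : Block β 𝔻} {v : ℕ} {t : ℝ} (h : E.DirectlyCommits r B v t) (n : ℕ) :
    ∀ j ∈ E.honest, ∀ C, ∀ w > v, ∀ u ≤ (n : ℝ) * S.Δ, E.VotesAt j C w u → S.Extends C B := by
  obtain ⟨c, rfl, rfl, hck, hca⟩ := hE.exists_cert_of_directlyCommits hr h
  induction n with
  | zero =>
    intro j hj C w _ u hu hv
    -- The timer would have been set at a negative time, before any honest replica starts.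
    obtain ⟨⟨P, -, -, hP⟩, -⟩ := hv
    obtain ⟨s, hs, hes⟩ := hP.1.1.1
    obtain ⟨s', hs', hes'⟩ := hes.exists_le (Nat.zero_le _)
    simp only [Enters] at hes'
    have := (hE.protocol j hj).start_nonneg
    have := S.Δ_pos
    rw [Nat.cast_zero, zero_mul] at hu
    linarith
  | succ n ih =>
    intro j hj C w hw u hu hv
    obtain ⟨⟨P, rfl, rfl, hP⟩, -⟩ := hv
    have hu' : u - S.Δ ≤ n * S.Δ := by
      push_cast at hu
      linarith
    have ih' : ∀ j ∈ E.honest, ∀ C, ∀ w > c.view, ∀ s ≤ u - S.Δ, E.VotesAt j C w s →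
        S.Extends C c.block := fun j hj C w hw s hs => ih j hj C w hw s (hs.trans hu')
    obtain ⟨⟨⟨e, he, hje⟩, -⟩, hhas, hvalid, -, ⟨T, hT, o, ho, hext⟩ | ⟨-, o, ho, hext⟩⟩ := hP.1
    · obtain ⟨v', hv', hcard, hTv⟩ := hvalid.2 T hT
      -- An honest status sender reported on entering view `P.view`, when `c` was already active for
      -- it. So its report `c₁`, and therefore the highest certificate `c₂` in `T`, ranks at least
      -- as high as `c`.
      obtain ⟨i, hiT, hi⟩ := hE.exists_honest_mem hcard
      obtain ⟨s, hsT, rfl⟩ := Finset.mem_image.1 hiT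
      have hin : ∀ s ∈ T, ∀ x ∈ s.contents, E.Has j x (u - S.Δ) := fun s hs x hx =>
        hhas.of_mem_contents (Or.inr ⟨T, hT, s, hs, hx⟩)
      obtain ⟨q, a, -, hsend⟩ := hE.exists_sends_of_has (hin s hsT _ (Or.inl rfl)) hi
      obtain ⟨-, -, hent, hhigh⟩ := (hE.protocol _ hi).status_only s q a hsend
      rw [(hTv s hsT).1, hv'] at hent
      obtain ⟨c₁, hc₁, hle₁⟩ := hhigh.2 c (hca _ hi _ hw _ _ hent le_rfl)
      obtain ⟨c₂, rfl, hle₂⟩ := ho.2 s hsT c₁ hc₁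
      obtain ⟨s₂, hs₂, hc₂⟩ := ho.1
      have hk : E.KnowsCert j c₂ (u - S.Δ) :=
        ⟨(hTv s₂ hs₂).2 c₂ hc₂, fun x hx => hin s₂ hs₂ x (Or.inr ⟨c₂, hc₂, hx⟩)⟩
      exact (hext c₂ rfl).trans (hE.extends_of_rank_le hck hk (hle₁.trans hle₂) ih')
    -- Without status messages the voter compares with its own highest certificate, and `c` is
    -- active for the voter itself.
    · obtain ⟨c₂, rfl, hle⟩ := ho.2 c (hca j hj _ hw _ _ hje he)
      exact (hext c₂ rfl).trans (hE.extends_of_rank_le hck (ho.1 c₂ rfl).1 hle ih')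

/-- After a direct commit, honest replicas vote in later views only for extensions. -/
theorem extends_of_votesAt (hE : E.IsExecution) {r j : S.Replica} (hr : r ∈ E.honest)
    (hj : j ∈ E.honest) {B C : Block β 𝔻} {v w : ℕ} {t u : ℝ} (h : E.DirectlyCommits r B v t)
    (hvw : v < w) (hC : E.VotesAt j C w u) : S.Extends C B := by
  obtain ⟨n, hn⟩ := exists_nat_ge (u / S.Δ)
  exact hE.extends_of_votesAt_of_lt hr h n j hj C w hvw u ((div_le_iff₀ S.Δ_pos).1 hn) hC

/-- Directly committed blocks do not equivocate. -/
theorem extends_or_extends_of_directlyCommits (hE : E.IsExecution) {r r' : S.Replica}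
    (hr : r ∈ E.honest) (hr' : r' ∈ E.honest) {B B' : Block β 𝔻} {v v' : ℕ} {t t' : ℝ}
    (h : E.DirectlyCommits r B v t) (h' : E.DirectlyCommits r' B' v' t') :
    S.Extends B B' ∨ S.Extends B' B := by
  obtain ⟨c, hcB, hcv, hc⟩ := h.1.1.2
  obtain ⟨c', hcB', hcv', hc'⟩ := h'.1.1.2
  obtain ⟨i, hi, s, -, hv⟩ := hE.exists_honest_vote hc
  obtain ⟨j, hj, s', -, hv'⟩ := hE.exists_honest_vote hc'
  rw [hcB, hcv] at hv
  rw [hcB', hcv'] at hv'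
  rcases lt_trichotomy v v' with hlt | rfl | hlt
  · exact Or.inr (hE.extends_of_votesAt hr hj h hlt hv')
  · exact hE.extends_or_extends_of_votesAt hi hj hv hv'
  · exact Or.inl (hE.extends_of_votesAt hr' hi h' hlt hv)

end IsExecution

end Trace

end OneDeltaSMR

theorem mainTheorem3 {β 𝔻 : Type*} (S : OneDeltaSMR.Setting β 𝔻) (E : OneDeltaSMR.Trace S)
    (hE : E.IsExecution) (r r' : S.Replica) (hr : r ∈ E.honest) (hr' : r' ∈ E.honest)
    (k : ℕ) (B B' : OneDeltaSMR.Block β 𝔻) (hB : S.HasHeight B k) (hB' : S.HasHeight B' k)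
    (hc : E.Commits r B) (hc' : E.Commits r' B') : B = B' := by
  obtain ⟨B₀, v, t, h, hext⟩ := hc
  obtain ⟨B₀', v', t', h', hext'⟩ := hc'
  -- Both blocks are ancestors of whichever directly committed block extends the other.
  rcases hE.extends_or_extends_of_directlyCommits hr hr' h h' with hx | hx
  · exact hext.eq_of_height (hx.trans hext') hB hB'
  · exact (hx.trans hext).eq_of_height hext' hB hB'
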